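/- Let $R$ be a regular noetherian commutative ring of finite Krull dimension and let $G$ be a finite group. Let $\mathrm{Rep}(G,R)=\mathrm{Fun}(BG,\mathrm{Perf}(R))$ be the stable $\infty$-category of perfect complexes of $R$-modules with a $G$-action. Its homotopy category is the full triangulated subcategory of the derived category $D(R[G])$ of $R$-linear representations of $G$ consisting of those objects whose underlying object of $D(R)$ is perfect, that is, belongs to the thick subcategory of $D(R)$ generated by $R$. For a subgroup $H\subseteq G$ let $R[G/H]\in\mathrm{Rep}(G,R)$ be the free $R$-module on the set $G/H$, placed in degree $0$, with $G$ permuting the basis by left translation. Then $\mathrm{Rep}(G,R)$ is generated as a thick subcategory by the permutation modules $R[G/H]$, $H\subseteq G$. That is, every object of $\mathrm{Rep}(G,R)$ lies in the smallest full subcategory of $\mathrm{Rep}(G,R)$ that contains all $R[G/H]$ and is closed under isomorphisms, shifts, extensions (if the two outer terms of a distinguished triangle belong to it, so does the middle one) and retracts. -/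

import Mathlib

open CategoryTheory CategoryTheory.Limits

universe u v w₁ w₂

noncomputable section

namespace PerfectRep

section Perfect

variable (R : Type u) [CommRing R] [HasDerivedCategory.{w₁} (ModuleCat.{max u v} R)]

/-- The ring `R` as an object of its derived category `D(R)`, concentrated in degree `0`.
(The lift only adjusts universe levels.) -/
def unit : DerivedCategory (ModuleCat.{max u v} R) :=
  (DerivedCategory.singleFunctor (ModuleCat.{max u v} R) 0).obj (ModuleCat.of R (ULift.{v} R))

/-- The perfect objects of `D(R)`: the thick subcategory generated by `R`, i.e. the smallest
class of objects of `D(R)` that contains `R` and is closed under shifts, extensions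
and retracts. -/
def IsPerfect : ObjectProperty (DerivedCategory (ModuleCat.{max u v} R)) :=
  (ObjectProperty.singleton (unit.{u, v} R)).triangEnvelope

instance : (IsPerfect.{u, v} R).IsTriangulated := by
  unfold IsPerfect; infer_instance

instance : (IsPerfect.{u, v} R).IsStableUnderRetracts := by
  unfold IsPerfect; infer_instance

/-- Finite free modules are perfect. -/
lemma isPerfect_of_linearEquiv {ι : Type v} [Finite ι] (M : ModuleCat.{max u v} R)
    (e : M ≃ₗ[R] (ι → ULift.{v} R)) :
    IsPerfect.{u, v} R ((DerivedCategory.singleFunctor (ModuleCat.{max u v} R) 0).obj M) := by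
  let F := DerivedCategory.singleFunctor (ModuleCat.{max u v} R) 0
  let Z : ι → ModuleCat.{max u v} R := fun _ => ModuleCat.of R (ULift.{v} R)
  have h : IsPerfect.{u, v} R (∏ᶜ fun i => F.obj (Z i)) :=
    ObjectProperty.prop_product _ fun _ =>
      ObjectProperty.le_triangEnvelope _ _ (ObjectProperty.ofObj_apply _ ())
  let i : M ≅ ∏ᶜ Z := e.toModuleIso ≪≫ (ModuleCat.piIsoPi Z).symm
  exact (IsPerfect.{u, v} R).prop_of_iso (F.mapIso i ≪≫ PreservesProduct.iso F Z).symm h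

end Perfect

section Representations

variable (R : Type u) [CommRing R] (G : Type v) [Group G]
  [HasDerivedCategory.{w₁} (ModuleCat.{max u v} R)]
  [HasDerivedCategory.{w₂} (Rep.{max u v} R G)]

/-- The functor `D(R[G]) ⥤ D(R)` that forgets the action of `G`. Here `D(R[G])` is the derived
category of the abelian category `Rep R G` of `R`-linear representations of `G`. -/
abbrev forgetAction :
    DerivedCategory (Rep.{max u v} R G) ⥤ DerivedCategory (ModuleCat.{max u v} R) :=
  (forget₂ (Rep.{max u v} R G) (ModuleCat.{max u v} R)).mapDerivedCategory

/-- The objects of `D(R[G])` whose underlying object of `D(R)` is perfect. -/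
def IsUnderlyingPerfect : ObjectProperty (DerivedCategory (Rep.{max u v} R G)) :=
  (IsPerfect.{u, v} R).inverseImage (forgetAction.{u, v} R G)

instance : (IsUnderlyingPerfect.{u, v} R G).IsTriangulated := by
  unfold IsUnderlyingPerfect; infer_instance

instance : (IsUnderlyingPerfect.{u, v} R G).IsStableUnderRetracts where
  of_retract r h :=
    (IsPerfect.{u, v} R).prop_of_retract (r.map (forgetAction.{u, v} R G)) h

/-- The triangulated category `Rep(G, R)` of perfect complexes of `R`-modules with an action
of `G`, i.e. the homotopy category of the stable `∞`-category `Fun(BG, Perf(R))`. As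
`Fun(BG, D(R))` is `D(R[G])`, it is the full subcategory of `D(R[G])` on the objects
whose underlying object of `D(R)` is perfect; shift and distinguished triangles are those
of `D(R[G])`. -/
abbrev PerfRep := (IsUnderlyingPerfect.{u, v} R G).FullSubcategory

/-- The permutation module `R[G/H]`: the free `R`-module on `G ⧸ H`, with `G` permuting the basis
by left translation, placed in degree `0`. -/
def permutationModule [Finite G] (H : Subgroup G) : PerfRep.{u, v} R G where
  obj := (DerivedCategory.singleFunctor (Rep.{max u v} R G) 0).obj (Rep.ofMulAction R G (G ⧸ H))
  property := by
    let M := Rep.ofMulAction R G (G ⧸ H)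
    let e : M.V ≃ₗ[R] (G ⧸ H → ULift.{v} R) :=
      (MonoidAlgebra.coeffLinearEquiv R).trans
        ((Finsupp.linearEquivFunOnFinite R R (G ⧸ H)).trans
          (LinearEquiv.piCongrRight fun _ => ULift.moduleEquiv.symm))
    exact (IsPerfect.{u, v} R).prop_of_iso
      (((forget₂ (Rep.{max u v} R G) (ModuleCat.{max u v} R)).mapDerivedCategorySingleFunctor
        0).app M).symm
      (isPerfect_of_linearEquiv.{u, v} R _ e)

end Representations

end PerfectRep

end

/-!
The argument works in `D(R[G])`. Let `T` be a thick subcategory containing the permutation modules;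
it has to contain every object `X` whose underlying complex is perfect. The homology of `X` is
bounded and finitely generated over the noetherian ring `R`, so by dévissage along the canonical
t-structure (`ObjectProperty.prop_of_boundedHomology`) it is enough that `T` contains every finitely
generated `R[G]`-module `M` (`Rep.prop_singleFunctor_of_finite`). The modules that belong to `T`
have the two-out-of-three property for short exact sequences and are closed under retracts.

* For a subgroup `S` and a finitely generated `R`-module `N`, the coinduction to `G` of the trivial
  `S`-representation `N` is in `T`: it depends exactly on `N` and is `R[G/S]` for `N = R`, and `N`
  has finite projective dimension because `R` is regular of finite dimension
  (`IsRegularRing.exists_hasProjectiveDimensionLE`).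
* If `p` kills `M` and `S` is a Sylow `p`-subgroup, then `M` is a retract of the coinduction of its
  restriction to `S`, the index of `S` being invertible modulo `p`. Over the `p`-group `S`, the
  module `M` has a finite filtration with trivial quotients, because a nonzero `p`-torsion
  representation has nonzero invariants. So `M` is in `T`, and with it every `M` killed by a
  positive integer.
* For arbitrary `M`, multiplication by the order of `G` on `M` factors through the coinduction of
  `M` from the trivial subgroup, which is in `T`. Its kernel and cokernel are torsion, hence in `T`,
  so in the Verdier quotient by `T` it is both zero and an isomorphism, and `M` is in `T`
  (`ObjectProperty.prop_singleFunctor_of_comp`).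
-/

universe w

/-! ### Projective dimension over regular rings -/

namespace IsRegularLocalRing
open IsLocalRing

/-- A regular local ring of positive dimension has a regular parameter `x`: one of a minimal system
of generators of the maximal ideal, so that `A ⧸ x` is regular of dimension one less. -/
lemma exists_quotient_isRegularLocalRing {A : Type u} [CommRing A] [IsRegularLocalRing A] {n : ℕ}
    (hn : (maximalIdeal A).spanFinrank = n + 1) :
    ∃ x ∈ maximalIdeal A, IsRegularLocalRing (A ⧸ Ideal.span {x}) ∧
      ringKrullDim (A ⧸ Ideal.span {x}) = n := by
  have fg := (maximalIdeal A).fg_of_isNoetherianRing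
  have card := Submodule.FG.generators_ncard fg
  have fin := Submodule.FG.finite_generators fg
  have hne : (maximalIdeal A).generators.Nonempty := by
    rw [← Set.ncard_pos fin]; omega
  obtain ⟨x, hx⟩ := hne
  have hxm : x ∈ maximalIdeal A := Submodule.FG.generators_mem _ hx
  have hle : Ideal.span {x} ≤ maximalIdeal A := by
    rwa [Ideal.span_le, Set.singleton_subset_iff]
  have hntop : Ideal.span {x} ≠ ⊤ := fun h =>
    (maximalIdeal.isMaximal A).ne_top (top_le_iff.1 (h ▸ hle))
  have : Nontrivial (A ⧸ Ideal.span {x}) := Ideal.Quotient.nontrivial_iff.mpr hntop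
  have : IsLocalRing (A ⧸ Ideal.span {x}) :=
    .of_surjective' _ Ideal.Quotient.mk_surjective
  have hmap : maximalIdeal (A ⧸ Ideal.span {x}) =
      (maximalIdeal A).map (Ideal.Quotient.mk (Ideal.span {x})) := by
    rw [IsLocalRing.map_maximalIdeal_of_surjective _ Ideal.Quotient.mk_surjective]
  have hspan : maximalIdeal (A ⧸ Ideal.span {x}) = Ideal.span
      (Ideal.Quotient.mk (Ideal.span {x}) '' ((maximalIdeal A).generators \ {x})) := by
    rw [hmap]
    conv_lhs => rw [← Submodule.span_generators (maximalIdeal A)]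
    rw [← Ideal.span, Ideal.map_span]
    apply le_antisymm
    · rw [Ideal.span_le]
      rintro _ ⟨y, hy, rfl⟩
      by_cases hyx : y = x
      · subst hyx
        rw [Ideal.Quotient.eq_zero_iff_mem.2 (Ideal.mem_span_singleton_self y)]
        exact zero_mem _
      · exact Ideal.subset_span ⟨y, ⟨hy, hyx⟩, rfl⟩
    · exact Ideal.span_mono (Set.image_mono Set.sdiff_subset)
  have hrank : (maximalIdeal (A ⧸ Ideal.span {x})).spanFinrank ≤ n := by
    rw [hspan]
    have fin' : ((maximalIdeal A).generators \ {x}).Finite := fin.subset Set.sdiff_subset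
    refine (Submodule.spanFinrank_span_le_ncard_of_finite (fin'.image _)).trans
      ((Set.ncard_image_le fin').trans ?_)
    rw [Set.ncard_sdiff_singleton_of_mem hx]
    omega
  have hdim : (n : WithBot ℕ∞) ≤ ringKrullDim (A ⧸ Ideal.span {x}) := by
    have h := ringKrullDim_le_ringKrullDim_quotient_add_card ({x} : Finset A)
      (by
      simpa [IsLocalRing.ringJacobson_eq_maximalIdeal] using hxm)
    rw [← spanFinrank_maximalIdeal, hn] at h
    rw [Nat.cast_succ, Finset.coe_singleton, Finset.card_singleton] at h
    exact (ENat.WithBot.add_le_add_natCast_right_iff (c := 1)).1 h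
  have hreg : IsRegularLocalRing (A ⧸ Ideal.span {x}) :=
    of_spanFinrank_maximalIdeal_le _ (le_trans (by exact_mod_cast hrank) hdim)
  refine ⟨x, hxm, hreg, le_antisymm ?_ hdim⟩
  rw [← spanFinrank_maximalIdeal]
  exact_mod_cast hrank

/-- The Krull dimension is attained on the quotient by the least prime of a chain of primes. -/
lemma exists_prime_le_ringKrullDim_quotient {A : Type u} [CommRing A] {n : ℕ}
    (h : (n : WithBot ℕ∞) ≤ ringKrullDim A) :
    ∃ q : Ideal A, q.IsPrime ∧ (n : WithBot ℕ∞) ≤ ringKrullDim (A ⧸ q) := by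
  obtain ⟨l, hl⟩ := Order.le_krullDim_iff.1 h
  refine ⟨l.head.asIdeal, l.head.2, ?_⟩
  rw [ringKrullDim_quotient, Order.le_krullDim_iff]
  exact ⟨⟨l.length, fun i => ⟨l i, l.head_le i⟩, fun i => l.step i⟩, hl⟩

/-- Regular local rings are domains. By induction `(x)` is prime for a regular parameter `x`. A
prime `q` with `dim A ⧸ q = dim A` cannot contain `x`, is contained in `(x)` by a comparison of
dimensions, and therefore satisfies `q = x q`; so `q = 0` by Nakayama's lemma. -/
theorem isDomain (A : Type u) [CommRing A] [IsRegularLocalRing A] : IsDomain A := by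
  obtain ⟨n, hn⟩ : ∃ n, (maximalIdeal A).spanFinrank = n := ⟨_, rfl⟩
  induction n generalizing A with
  | zero =>
    have hbot := (Submodule.spanFinrank_eq_zero_iff_eq_bot
      (maximalIdeal A).fg_of_isNoetherianRing).1 hn
    exact (IsLocalRing.isField_iff_maximalIdeal_eq.2 hbot).isDomain
  | succ n ih =>
    obtain ⟨x, hxm, hreg, hdim⟩ := exists_quotient_isRegularLocalRing hn
    have hdom := ih (A ⧸ Ideal.span {x}) (by
      have := hreg.spanFinrank_maximalIdeal
      rw [hdim] at this
      exact_mod_cast this)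
    have hA : ((n + 1 : ℕ) : WithBot ℕ∞) = ringKrullDim A := by
      rw [← hn, spanFinrank_maximalIdeal]
    obtain ⟨q, hq, hqdim⟩ := exists_prime_le_ringKrullDim_quotient hA.le
    have not_le {k : WithBot ℕ∞} (h₁ : ((n + 1 : ℕ) : WithBot ℕ∞) ≤ k)
        (h₂ : k ≤ n) : False := by
      have := h₁.trans h₂
      norm_cast at this
      omega
    have hxq : x ∉ q := fun hx => by
      have hle : Ideal.span {x} ≤ q := by rwa [Ideal.span_le, Set.singleton_subset_iff]
      exact not_le hqdim ((ringKrullDim_le_of_surjective (Ideal.Quotient.factor hle)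
        (Ideal.Quotient.factor_surjective hle)).trans hdim.le)
    have hqx : q ≤ Ideal.span {x} := by
      intro r hr
      -- Otherwise `A ⧸ (x, q)` is a quotient of the domain `A ⧸ x` of dimension less than `n`, and
      -- also the quotient of `A ⧸ q`, of dimension at least `n + 1`, by one element.
      by_contra hrx
      have hr0 : Ideal.Quotient.mk (Ideal.span {x}) r ∈ nonZeroDivisors _ :=
        mem_nonZeroDivisors_of_ne_zero (by rwa [Ne, Ideal.Quotient.eq_zero_iff_mem])
      have h₁ := ringKrullDim_succ_le_of_surjective
        (Ideal.Quotient.factor (le_sup_left : Ideal.span {x} ≤ Ideal.span {x} ⊔ q))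
        (Ideal.Quotient.factor_surjective le_sup_left) hr0 (by
          simpa [Ideal.Quotient.eq_zero_iff_mem] using Ideal.mem_sup_right hr)
      rw [hdim] at h₁
      have h₂ := ringKrullDim_le_ringKrullDim_quotient_add_card
        ({Ideal.Quotient.mk q x} : Finset (A ⧸ q)) (by
          have : IsLocalRing (A ⧸ q) := .of_surjective' _ Ideal.Quotient.mk_surjective
          rw [Finset.coe_singleton, Set.singleton_subset_iff, ringJacobson_eq_maximalIdeal,
            ← map_maximalIdeal_of_surjective _ (Ideal.Quotient.mk_surjective (I := q))]
          exact Ideal.mem_map_of_mem _ hxm)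
      rw [Finset.coe_singleton, Finset.card_singleton] at h₂
      let f : A ⧸ (Ideal.span {x} ⊔ q) →+* (A ⧸ q) ⧸ Ideal.span {Ideal.Quotient.mk q x} :=
        Ideal.Quotient.lift _ ((Ideal.Quotient.mk _).comp (Ideal.Quotient.mk q)) (by
          intro a ha
          have : Ideal.span {x} ⊔ q ≤ RingHom.ker
              ((Ideal.Quotient.mk (Ideal.span {Ideal.Quotient.mk q x})).comp
                (Ideal.Quotient.mk q)) := by
            rw [sup_le_iff, Ideal.span_le, Set.singleton_subset_iff]
            refine ⟨?_, fun b hb => ?_⟩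
            · simp [RingHom.mem_ker]
            · rw [RingHom.mem_ker, RingHom.comp_apply, Ideal.Quotient.eq_zero_iff_mem.2 hb,
                map_zero]
          exact this ha)
      have hf : Function.Surjective f := Ideal.Quotient.lift_surjective_of_surjective _ _
        (Ideal.Quotient.mk_surjective.comp Ideal.Quotient.mk_surjective)
      refine not_le (hqdim.trans h₂) (le_trans ?_ h₁)
      rw [Nat.cast_one]
      exact add_le_add_left (ringKrullDim_le_of_surjective f hf) 1
    have hq0 : q = ⊥ := by
      refine Submodule.eq_bot_of_le_smul_of_le_jacobson_bot (maximalIdeal A) q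
        q.fg_of_isNoetherianRing (fun r hr => ?_) (maximalIdeal_le_jacobson _)
      obtain ⟨a, rfl⟩ := Ideal.mem_span_singleton'.1 (hqx hr)
      rw [mul_comm]
      exact Ideal.mul_mem_mul hxm ((hq.mem_or_mem hr).resolve_right hxq)
    subst hq0
    exact IsDomain.of_bot_isPrime A

end IsRegularLocalRing

namespace ModuleCat

section ChangeOfRings

variable {A : Type u} [CommRing A] {x : A}

/-- A free module over `A ⧸ x` is the cokernel of multiplication by `x` on a free module
over `A`. -/
lemma hasProjectiveDimensionLE_one_finsupp_quotient (hx : IsSMulRegular A x)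
    (ι : Type (max u v)) :
    HasProjectiveDimensionLE (ModuleCat.of A (ι →₀ (A ⧸ Ideal.span {x}))) 1 := by
  classical
  let f : (ι →₀ A) →ₗ[A] (ι →₀ A) := LinearMap.lsmul A _ x
  let g : (ι →₀ A) →ₗ[A] (ι →₀ (A ⧸ Ideal.span {x})) :=
    Finsupp.mapRange.linearMap (Submodule.mkQ (Ideal.span {x}))
  have hfg : Function.Exact f g := by
    intro y
    constructor
    · intro hy
      have hmem (i : ι) : y i ∈ Ideal.span {x} := by
        rw [← Ideal.Quotient.eq_zero_iff_mem]
        exact DFunLike.congr_fun hy i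
      choose c hc using fun i => Ideal.mem_span_singleton'.1 (hmem i)
      refine ⟨Finsupp.onFinset y.support c fun i hi => ?_, ?_⟩
      · rw [Finsupp.mem_support_iff]
        rintro h0
        apply hi
        apply hx
        simpa [mul_comm, h0] using hc i
      · ext i
        simpa [f, mul_comm] using hc i
    · rintro ⟨z, rfl⟩
      ext i
      exact Ideal.Quotient.eq_zero_iff_mem.2
        (Ideal.mul_mem_right (z i) _ (Ideal.mem_span_singleton_self x))
  let S := ModuleCat.shortComplexOfCompEqZero f g hfg.linearMap_comp_eq_zero
  have hS : S.ShortExact := ModuleCat.shortComplex_shortExact S hfg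
    (fun y z h => by
      ext i
      exact hx (DFunLike.congr_fun h i))
    (Finsupp.mapRange_surjective _ rfl (Submodule.mkQ_surjective _))
  have h₁ : Projective S.X₁ := ModuleCat.projective_of_free (Finsupp.basisSingleOne (R := A))
  have h₂ : Projective S.X₂ := ModuleCat.projective_of_free (Finsupp.basisSingleOne (R := A))
  exact hS.hasProjectiveDimensionLT_X₃ 1 inferInstance inferInstance

/-- If `x` is a nonzerodivisor of `A`, then the projective dimension of a module over `A ⧸ x` goes
up by at most `1` when it is viewed as a module over `A`. -/
lemma hasProjectiveDimensionLE_succ_of_quotient (hx : IsSMulRegular A x) (n : ℕ)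
    (N : Type (max u v)) [AddCommGroup N] [Module A N] [Module (A ⧸ Ideal.span {x}) N]
    [IsScalarTower A (A ⧸ Ideal.span {x}) N]
    (hN : HasProjectiveDimensionLE (ModuleCat.of (A ⧸ Ideal.span {x}) N) n) :
    HasProjectiveDimensionLE (ModuleCat.of A N) (n + 1) := by
  let B := A ⧸ Ideal.span {x}
  have hfree := hasProjectiveDimensionLE_one_finsupp_quotient.{u, v} hx N
  let p : (N →₀ B) →ₗ[B] N := Finsupp.linearCombination B id
  have hp : Function.Surjective p := Finsupp.linearCombination_id_surjective B N
  induction n generalizing N with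
  | zero =>
    have : Projective (ModuleCat.of B N) := (projective_iff_hasProjectiveDimensionLE_zero _).2 hN
    have : Module.Projective B N := (IsProjective.iff_projective N).2 this
    obtain ⟨s, hs⟩ := Module.projective_lifting_property p LinearMap.id hp
    let r : Retract (ModuleCat.of A N) (ModuleCat.of A (N →₀ B)) :=
      { i := ModuleCat.ofHom (s.restrictScalars A)
        r := ModuleCat.ofHom (p.restrictScalars A)
        retract := by
          ext y
          exact LinearMap.congr_fun hs y }
    exact r.hasProjectiveDimensionLT 2
  | succ n ih =>
    let K := LinearMap.ker p
    have hSB := LinearMap.shortExact_shortComplexKer hp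
    have : Projective p.shortComplexKer.X₂ :=
      ModuleCat.projective_of_free (Finsupp.basisSingleOne (R := B))
    have hK : HasProjectiveDimensionLE (ModuleCat.of B K) n :=
      (hSB.hasProjectiveDimensionLT_X₃_iff n this).1 hN
    have hK' := ih K hK (hasProjectiveDimensionLE_one_finsupp_quotient.{u, v} hx K)
      (Finsupp.linearCombination_id_surjective B K)
    let S : ShortComplex (ModuleCat A) :=
      { X₁ := ModuleCat.of A K
        X₂ := ModuleCat.of A (N →₀ B)
        X₃ := ModuleCat.of A N
        f := ModuleCat.ofHom (K.subtype.restrictScalars A)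
        g := ModuleCat.ofHom (p.restrictScalars A)
        zero := by
          ext y
          exact y.2 }
    have hS : S.ShortExact := ModuleCat.shortComplex_shortExact S
      (fun y => ⟨fun hy => ⟨⟨y, hy⟩, rfl⟩, by rintro ⟨z, rfl⟩; exact z.2⟩)
      Subtype.val_injective hp
    have := hfree
    exact hS.hasProjectiveDimensionLT_X₃ (n + 2) hK'
      (hasProjectiveDimensionLT_of_ge _ 2 _ (by omega))

end ChangeOfRings

end ModuleCat

/-- Finitely generated modules over a regular local ring of dimension `n` have projective dimension
at most `n`. The induction passes from `A` to `A ⧸ x` for a regular parameter `x`, which is a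
nonzerodivisor on the first syzygy of `M`. -/
theorem IsRegularLocalRing.hasProjectiveDimensionLE {A : Type u} [CommRing A]
    [IsRegularLocalRing A] {n : ℕ} (hn : ringKrullDim A = n) (M : ModuleCat.{max u v} A)
    [Module.Finite A M] : HasProjectiveDimensionLE M n := by
  have hrank : (IsLocalRing.maximalIdeal A).spanFinrank = n := by
    exact_mod_cast (IsRegularLocalRing.spanFinrank_maximalIdeal (R := A)).trans hn
  have hdom := IsRegularLocalRing.isDomain A
  induction n generalizing A with
  | zero =>
    have hbot := (Submodule.spanFinrank_eq_zero_iff_eq_bot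
      (IsLocalRing.maximalIdeal A).fg_of_isNoetherianRing).1 hrank
    have : IsSimpleOrder (Ideal A) :=
      Ring.isField_iff_isSimpleOrder_ideal.1 (IsLocalRing.isField_iff_maximalIdeal_eq.2 hbot)
    have : IsSimpleModule A A := (isSimpleModule_iff A A).2 this
    have : IsSemisimpleRing A := inferInstanceAs (IsSemisimpleModule A A)
    have : Module.Projective A M := Module.projective_of_isSemisimpleRing A M
    rw [← projective_iff_hasProjectiveDimensionLE_zero, ← IsProjective.iff_projective]
    infer_instance
  | succ n ih =>
    obtain ⟨x, hxm, hreg, hdim⟩ := exists_quotient_isRegularLocalRing hrank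
    have hx0 : x ≠ 0 := by
      rintro rfl
      have e : ringKrullDim (A ⧸ Ideal.span {(0 : A)}) = ringKrullDim A := by
        rw [ringKrullDim_eq_of_ringEquiv ((Ideal.quotEquivOfEq
          (Ideal.span_singleton_eq_bot.2 rfl)).trans (RingEquiv.quotientBot A))]
      rw [hdim, hn] at e
      norm_cast at e
      omega
    obtain ⟨F, _, _, _, _, f, hf⟩ := Module.exists_finite_presentation A M
    have hS := LinearMap.shortExact_shortComplexKer hf
    have hF : Projective f.shortComplexKer.X₂ :=
      ModuleCat.projective_of_free (Module.Free.chooseBasis A F)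
    refine (hS.hasProjectiveDimensionLT_X₃_iff n hF).2 ?_
    let K := LinearMap.ker f
    have hreg' : IsSMulRegular K x := fun a b h => by
      have : Module.IsTorsionFree A F := inferInstance
      exact smul_right_injective K hx0 h
    have hQ : HasProjectiveDimensionLE
        (ModuleCat.of (A ⧸ Ideal.span {x}) (QuotSMulTop x K)) n := by
      have : Module.Finite (A ⧸ Ideal.span {x}) (QuotSMulTop x K) :=
        Module.Finite.of_restrictScalars_finite A _ _
      exact @ih (A ⧸ Ideal.span {x}) _ hreg hdim _ ‹_› (by
        exact_mod_cast (IsRegularLocalRing.spanFinrank_maximalIdeal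
          (R := A ⧸ Ideal.span {x})).trans hdim) (IsRegularLocalRing.isDomain _)
    have hQ' := ModuleCat.hasProjectiveDimensionLE_succ_of_quotient.{u, v}
      (IsSMulRegular.of_ne_zero hx0) n (QuotSMulTop x K) hQ
    change HasProjectiveDimensionLE _ (n + 1) at hQ'
    rw [← projectiveDimension_le_iff,
      ModuleCat.projectiveDimension_quotSMulTop_eq_succ_of_isSMulRegular (ModuleCat.of A K) x
        hreg' hxm] at hQ'
    exact (projectiveDimension_le_iff _ n).1
      ((ENat.WithBot.add_le_add_natCast_right_iff (c := 1)).1 (by exact_mod_cast hQ'))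

/-- Over a regular ring of finite Krull dimension the projective dimension of finitely generated
modules is bounded, as it can be computed after localization at the maximal ideals. -/
theorem IsRegularRing.exists_hasProjectiveDimensionLE {R : Type u} [CommRing R]
    [IsRegularRing R] (hdim : ringKrullDim R ≠ ⊤) :
    ∃ n : ℕ, ∀ (M : ModuleCat.{max u v} R) [Module.Finite R M], HasProjectiveDimensionLE M n := by
  obtain ⟨n, hn⟩ : ∃ n : ℕ, ringKrullDim R ≤ n := by
    cases h : ringKrullDim R with
    | bot => exact ⟨0, bot_le⟩
    | coe d =>
      cases d with
      | top => exact absurd h hdim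
      | coe n => exact ⟨n, le_rfl⟩
  refine ⟨n, fun M _ => (M.hasProjectiveDimensionLE_iff_forall_maximalSpectrum n).2 fun m => ?_⟩
  let A := Localization.AtPrime m.asIdeal
  have hA : ringKrullDim A = m.asIdeal.height :=
    IsLocalization.AtPrime.ringKrullDim_eq_height m.asIdeal A
  have hle := (Ideal.height_le_ringKrullDim_of_ne_top m.isMaximal.ne_top).trans hn
  obtain ⟨k, hk⟩ := ENat.ne_top_iff_exists.1
    (show m.asIdeal.height ≠ ⊤ from fun h => by
      rw [h] at hle
      exact ENat.natCast_ne_top n (top_le_iff.1 (WithBot.coe_le_coe.1 hle)))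
  rw [← hk] at hA hle
  have : Module.Finite A (M.localizedModule m.asIdeal.primeCompl) :=
    Module.Finite.of_isLocalizedModule m.asIdeal.primeCompl
      (M.localizedModuleMkLinearMap m.asIdeal.primeCompl)
  have := IsRegularLocalRing.hasProjectiveDimensionLE.{u, v} (A := A) hA
    (M.localizedModule m.asIdeal.primeCompl)
  exact hasProjectiveDimensionLT_of_ge _ (k + 1) _ (by
    have : k ≤ n := by exact_mod_cast hle
    omega)

/-! ### Thick subcategories and dévissage in derived categories -/

namespace CategoryTheory

open Pretriangulated

namespace ObjectProperty

section Thick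

variable {A : Type*} [Category* A] [Abelian A]

/-- A property of objects of an abelian category is thick if it is closed under retracts and has
the two-out-of-three property for short exact sequences. -/
structure IsThick (P : ObjectProperty A) : Prop where
  of_retract {X Y : A} (r : Retract X Y) (hY : P Y) : P X
  X₁ {S : ShortComplex A} (hS : S.ShortExact) (h₂ : P S.X₂) (h₃ : P S.X₃) : P S.X₁
  X₂ {S : ShortComplex A} (hS : S.ShortExact) (h₁ : P S.X₁) (h₃ : P S.X₃) : P S.X₂
  X₃ {S : ShortComplex A} (hS : S.ShortExact) (h₁ : P S.X₁) (h₂ : P S.X₂) : P S.X₃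

namespace IsThick

variable {P : ObjectProperty A} (hP : P.IsThick)

include hP

lemma of_iso {X Y : A} (e : X ≅ Y) (hX : P X) : P Y :=
  hP.of_retract e.symm.retract hX

lemma of_isZero {X Y : A} (hX : IsZero X) (hY : P Y) : P X :=
  hP.of_retract (hX.retract Y) hY

lemma inverseImage {B : Type*} [Category* B] [Abelian B] (F : B ⥤ A) [F.PreservesZeroMorphisms]
    (hF : ∀ {S : ShortComplex B}, S.ShortExact → (S.map F).ShortExact) :
    (P.inverseImage F).IsThick where
  of_retract r hY := hP.of_retract (r.map F) hY
  X₁ hS h₂ h₃ := hP.X₁ (hF hS) h₂ h₃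
  X₂ hS h₁ h₃ := hP.X₂ (hF hS) h₁ h₃
  X₃ hS h₁ h₂ := hP.X₃ (hF hS) h₁ h₂

end IsThick

end Thick

section ModuleCat

variable {R : Type u} [CommRing R] {P : ObjectProperty (ModuleCat.{max u v} R)}

lemma IsThick.of_finite_of_free (hP : P.IsThick) (hR : P (ModuleCat.of R (ULift.{v} R)))
    (M : ModuleCat.{max u v} R) [Module.Finite R M] [Module.Free R M] : P M := by
  have key (n : ℕ) : P (ModuleCat.of R (Fin n → ULift.{v} R)) := by
    induction n with
    | zero =>
      exact hP.of_isZero ((ModuleCat.isZero_iff_subsingleton).2 inferInstance) hR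
    | succ n ih =>
      let f : ULift.{v} R →ₗ[R] (Fin (n + 1) → ULift.{v} R) :=
        LinearMap.single R (fun _ => ULift.{v} R) 0
      let g : (Fin (n + 1) → ULift.{v} R) →ₗ[R] (Fin n → ULift.{v} R) :=
        LinearMap.funLeft R _ Fin.succ
      have hfg : Function.Exact f g := by
        intro y
        constructor
        · intro hy
          refine ⟨y 0, ?_⟩
          ext i
          refine Fin.cases ?_ (fun j => ?_) i
          · simp [f]
          · have := congrFun hy j
            simp [f, g, LinearMap.funLeft] at this ⊢
            rw [this]; rfl
        · rintro ⟨z, rfl⟩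
          ext j
          simp [f, g, LinearMap.funLeft]
      let S := ModuleCat.shortComplexOfCompEqZero f g hfg.linearMap_comp_eq_zero
      have hS : S.ShortExact := ModuleCat.shortComplex_shortExact S hfg
        (Pi.single_injective (M := fun _ : Fin (n + 1) => ULift.{v} R) 0)
        (LinearMap.funLeft_surjective_of_injective _ _ _ (Fin.succ_injective n))
      exact hP.X₂ hS hR ih
  let b := Module.Free.chooseBasis R M
  let e := Fintype.equivFin (Module.Free.ChooseBasisIndex R M)
  let l : M ≃ₗ[R] (Fin _ → ULift.{v} R) :=
    (b.reindex e).equivFun.trans (LinearEquiv.piCongrRight fun _ => ULift.moduleEquiv.symm)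
  exact hP.of_iso l.symm.toModuleIso (key _)

/-- A thick property of modules which holds for the ring holds for all finitely generated modules of
finite projective dimension. -/
lemma IsThick.of_finite_of_hasProjectiveDimensionLE [IsNoetherianRing R] (hP : P.IsThick)
    (hR : P (ModuleCat.of R (ULift.{v} R))) (n : ℕ) (M : ModuleCat.{max u v} R)
    [Module.Finite R M] [hM : HasProjectiveDimensionLE M n] : P M := by
  induction n generalizing M with
  | zero =>
    have : Projective M := (projective_iff_hasProjectiveDimensionLE_zero _).2 hM
    have : Module.Projective R M := (IsProjective.iff_projective M).2 this
    obtain ⟨F, _, _, _, _, f, hf⟩ := Module.exists_finite_presentation R M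
    obtain ⟨s, hs⟩ := Module.projective_lifting_property f LinearMap.id hf
    let r : Retract M (ModuleCat.of R F) :=
      { i := ModuleCat.ofHom s
        r := ModuleCat.ofHom f
        retract := by
          ext y
          exact LinearMap.congr_fun hs y }
    exact hP.of_retract r (hP.of_finite_of_free hR _)
  | succ n ih =>
    obtain ⟨F, _, _, _, _, f, hf⟩ := Module.exists_finite_presentation R M
    have hS := LinearMap.shortExact_shortComplexKer hf
    have hF : Projective f.shortComplexKer.X₂ :=
      ModuleCat.projective_of_free (Module.Free.chooseBasis R F)
    have := (hS.hasProjectiveDimensionLT_X₃_iff n hF).1 hM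
    exact hP.X₃ hS (@ih f.shortComplexKer.X₁ inferInstance this)
      (hP.of_finite_of_free hR (ModuleCat.of R F))

end ModuleCat

section Triangulated

variable {C : Type*} [Category* C] [HasZeroObject C] [HasShift C ℤ] [Preadditive C]
  [∀ (n : ℤ), (shiftFunctor C n).Additive] [Pretriangulated C] [IsTriangulated C]
  (T : ObjectProperty C) [T.IsTriangulated] [T.IsStableUnderRetracts]

/-- If a morphism `X ⟶ Y` has its cone in a thick subcategory and factors through an object of it,
then `X` belongs to it: the morphism is both zero and invertible in the Verdier quotient. -/
lemma prop_of_trW_comp {X Q Y : C} (f : X ⟶ Q) (g : Q ⟶ Y) (hQ : T Q) (h : T.trW (f ≫ g)) :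
    T X := by
  obtain ⟨F, j, d, hF, hTF⟩ := (T.trW_iff' _).1 h
  obtain ⟨Z, s, e, hs⟩ := distinguished_cocone_triangle₁ f
  have hsW : T.trW s := ⟨_, _, _, hs, hQ⟩
  have hs0 : s ≫ (f ≫ g) = 0 := by
    have : s ≫ f = 0 := comp_distTriang_mor_zero₁₂ _ hs
    rw [reassoc_of% this, zero_comp]
  -- As `s ≫ f ≫ g = 0`, the morphism `s` factors through the fibre `F` of `f ≫ g`.
  obtain ⟨t, ht⟩ : ∃ t : Z ⟶ F, s = t ≫ j := Triangle.coyoneda_exact₂ _ hF s hs0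
  obtain ⟨Z', s', e', hs'⟩ := distinguished_cocone_triangle₁ t
  have hsW' : T.trW s' := ⟨_, _, _, hs', hTF⟩
  have h0 : s' ≫ s = 0 := by
    have : s' ≫ t = 0 := comp_distTriang_mor_zero₁₂ _ hs'
    rw [ht, reassoc_of% this, zero_comp]
  -- The zero morphism to `X` has its cone in `T`, and `X` is a retract of that cone.
  have hW : T.trW (0 : Z' ⟶ X) := h0 ▸ T.trW.comp_mem _ _ hsW' hsW
  obtain ⟨W, p, q, hT, hW⟩ := hW
  obtain ⟨r, hr⟩ : ∃ r : W ⟶ X, 𝟙 X = p ≫ r :=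
    Triangle.yoneda_exact₂ _ hT (𝟙 X) zero_comp
  exact T.prop_of_retract ⟨p, r, hr.symm⟩ hW

end Triangulated

section Derived

open _root_.DerivedCategory

variable {A : Type*} [Category* A] [Abelian A] [HasDerivedCategory.{w} A]

/-- A short exact sequence is a distinguished triangle of the derived category. -/
lemma isThick_inverseImage_singleFunctor (T : ObjectProperty (DerivedCategory A))
    [T.IsTriangulated] [T.IsStableUnderRetracts] :
    (T.inverseImage (singleFunctor A 0)).IsThick where
  of_retract r hY := T.prop_of_retract (r.map (singleFunctor A 0)) hY
  X₁ hS h₂ h₃ := T.ext_of_isTriangulatedClosed₁ _ hS.singleTriangle_distinguished h₂ h₃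
  X₂ hS h₁ h₃ := T.ext_of_isTriangulatedClosed₂ _ hS.singleTriangle_distinguished h₁ h₃
  X₃ hS h₁ h₂ := T.ext_of_isTriangulatedClosed₃ _ hS.singleTriangle_distinguished h₁ h₂

/-- If the kernel and cokernel of `f ≫ g` belong to a thick subcategory of the derived category, and
`f ≫ g` factors through an object of it, then so does its source. -/
lemma prop_singleFunctor_of_comp (T : ObjectProperty (DerivedCategory A))
    [T.IsTriangulated] [T.IsStableUnderRetracts] {X Q Y : A} (f : X ⟶ Q) (g : Q ⟶ Y)
    (hQ : T ((singleFunctor A 0).obj Q)) (hker : T ((singleFunctor A 0).obj (kernel (f ≫ g))))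
    (hcoker : T ((singleFunctor A 0).obj (cokernel (f ≫ g)))) :
    T ((singleFunctor A 0).obj X) := by
  let h := f ≫ g
  let S₁ : ShortComplex A := ShortComplex.mk (kernel.ι h) (Abelian.factorThruImage h) (by
    rw [← cancel_mono (Abelian.image.ι h)]
    simp)
  let S₂ : ShortComplex A := ShortComplex.mk (Abelian.image.ι h) (cokernel.π h) (by simp)
  have hS₁ : S₁.ShortExact :=
    { exact := ShortComplex.exact_of_f_is_kernel _ (by
        refine KernelFork.IsLimit.ofι' _ _ (fun k hk => ?_)
        have hk' : k ≫ h = 0 := by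
          rw [← Abelian.image.fac h, ← Category.assoc]
          dsimp [S₁] at hk
          rw [hk, zero_comp]
        exact ⟨kernel.lift h k hk', kernel.lift_ι h k hk'⟩)
      mono_f := by dsimp [S₁]; infer_instance
      epi_g := by dsimp [S₁]; infer_instance }
  have hS₂ : S₂.ShortExact :=
    { exact := ShortComplex.exact_kernel (cokernel.π h)
      mono_f := by dsimp [S₂]; infer_instance
      epi_g := by dsimp [S₂]; infer_instance }
  have hW : T.trW ((singleFunctor A 0).map f ≫ (singleFunctor A 0).map g) := by
    rw [← Functor.map_comp]
    change T.trW ((singleFunctor A 0).map h)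
    rw [← Abelian.image.fac h, Functor.map_comp]
    exact T.trW.comp_mem _ _ (trW.mk' T hS₁.singleTriangle_distinguished hker)
      (trW.mk T hS₂.singleTriangle_distinguished hcoker)
  exact T.prop_of_trW_comp _ _ hQ hW

/-- The objects of the derived category whose homology objects all satisfy `P` and vanish outside a
bounded range of degrees. -/
def boundedHomology (P : ObjectProperty A) : ObjectProperty (DerivedCategory A) := fun X =>
  (∀ i : ℤ, P ((homologyFunctor A i).obj X)) ∧
    ∃ n : ℕ, ∀ i : ℤ, n < i.natAbs → IsZero ((homologyFunctor A i).obj X)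

variable (P : ObjectProperty A) [P.IsSerreClass]

instance : (boundedHomology P).IsStableUnderRetracts where
  of_retract {X Y} r := by
    rintro ⟨hP, n, hn⟩
    exact ⟨fun i => P.prop_of_mono (r.map (homologyFunctor A i)).i (hP i),
      n, fun i hi => (hn i hi).of_mono (r.map (homologyFunctor A i)).i⟩

lemma boundedHomology_of_triangle (T : Triangle (DerivedCategory A))
    (hT : T ∈ distTriang (DerivedCategory A))
    (h₁ : boundedHomology P T.obj₁) (h₃ : boundedHomology P T.obj₃) :
    boundedHomology P T.obj₂ := by
  obtain ⟨h₁, n, hn⟩ := h₁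
  obtain ⟨h₃, m, hm⟩ := h₃
  exact ⟨fun i => P.prop_X₂_of_exact (HomologySequence.exact₂ T hT i) (h₁ i) (h₃ i),
    max n m, fun i hi => ObjectProperty.prop_X₂_of_exact (IsZero (C := A))
      (HomologySequence.exact₂ T hT i) (hn i (by omega)) (hm i (by omega))⟩

instance : (boundedHomology P).IsStableUnderShift ℤ where
  isStableUnderShiftBy a := ⟨fun X hX => by
    obtain ⟨hP, n, hn⟩ := hX
    have e (i : ℤ) : (homologyFunctor A i).obj (X⟦a⟧) ≅ (homologyFunctor A (a + i)).obj X :=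
      ((homologyFunctor A 0).shiftIso a i (a + i) rfl).app X
    exact ⟨fun i => P.prop_of_iso (e i).symm (hP _),
      n + a.natAbs, fun i hi => (hn (a + i) (by omega)).of_iso (e i)⟩⟩

instance : (boundedHomology P).IsTriangulated where
  exists_zero := by
    obtain ⟨Z, hZ⟩ := HasZeroObject.zero (C := DerivedCategory A)
    exact ⟨Z, hZ, fun i => P.prop_of_isZero (Functor.map_isZero _ hZ),
      0, fun i _ => Functor.map_isZero _ hZ⟩
  toIsTriangulatedClosed₂ := .mk' fun T hT h₁ h₃ => boundedHomology_of_triangle P T hT h₁ h₃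

lemma boundedHomology_singleFunctor (M : A) (hM : P M) :
    boundedHomology P ((singleFunctor A 0).obj M) := by
  refine ⟨fun i => ?_, 0, fun i hi => ?_⟩
  · rcases lt_trichotomy i 0 with h | rfl | h
    · exact P.prop_of_isZero (isZero_of_isGE _ 0 i h)
    · exact P.prop_of_iso ((singleFunctorCompHomologyFunctorIso A 0).app M).symm hM
    · exact P.prop_of_isZero (isZero_of_isLE _ 0 i h)
  · rcases lt_or_gt_of_ne (show i ≠ 0 by rintro rfl; omega) with h | h
    · exact isZero_of_isGE _ 0 i h
    · exact isZero_of_isLE _ 0 i h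

/-- Dévissage along the canonical t-structure: an object with bounded homology is an iterated
extension of shifts of its homology objects. -/
lemma prop_of_boundedHomology (T : ObjectProperty (DerivedCategory A)) [T.IsTriangulated]
    [T.IsStableUnderRetracts] (hT : ∀ M, P M → T ((singleFunctor A 0).obj M))
    (X : DerivedCategory A) (hX : boundedHomology P X) : T X := by
  have single (n : ℤ) (M : A) (hM : P M) : T ((singleFunctor A n).obj M) :=
    T.prop_of_iso (((singleFunctors A).shiftIso (-n) n 0 (by simp)).app M)
      (T.le_shift (-n) _ (hT M hM))
  have key (n : ℕ) : ∀ (a : ℤ) (X : DerivedCategory A), boundedHomology P X → X.IsGE a →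
      X.IsLE (a + n) → T X := by
    induction n with
    | zero =>
      intro a X hX _ hle
      rw [Nat.cast_zero, add_zero] at hle
      obtain ⟨N, ⟨e⟩⟩ := exists_iso_singleFunctor_obj_of_isGE_of_isLE X a
      exact T.prop_of_iso e.symm (single a N (P.prop_of_iso
        ((homologyFunctor A a).mapIso e ≪≫ (singleFunctorCompHomologyFunctorIso A a).app N)
        (hX.1 a)))
    | succ n ih =>
      intro a X hX hge hle
      obtain ⟨b, hb⟩ : ∃ b : ℤ, a + n + 1 = b := ⟨_, rfl⟩
      have hle : X.IsLE b := by
        rwa [show a + ↑(n + 1) = b by push_cast; omega] at hle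
      have hΔ := TStructure.t.triangleLEGE_distinguished (a + n) b hb X
      let Y := (TStructure.t.truncLE (a + n)).obj X
      let Z := (TStructure.t.truncGE b).obj X
      -- The truncation `Z` is concentrated in degree `b`, with `H^b Z = H^b X`.
      have hYle : Y.IsLE (a + n) := by dsimp [Y]; infer_instance
      have hYge : Y.IsGE a := by dsimp [Y]; infer_instance
      have hZle : Z.IsLE b := by dsimp [Z]; infer_instance
      have hZge : Z.IsGE b := by dsimp [Z]; infer_instance
      have hZ : boundedHomology P Z := by
        refine ⟨fun i => ?_, b.natAbs, fun i hi => ?_⟩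
        · rcases lt_trichotomy i b with h | rfl | h
          · exact P.prop_of_isZero (isZero_of_isGE Z b i h)
          · exact P.prop_X₂_of_exact (HomologySequence.exact₃ _ hΔ i _ rfl) (hX.1 _)
              (P.prop_of_isZero (isZero_of_isLE Y (a + n) _ (by omega)))
          · exact P.prop_of_isZero (isZero_of_isLE Z b i h)
        · rcases lt_or_gt_of_ne (show i ≠ b by rintro rfl; omega) with h | h
          · exact isZero_of_isGE Z b i h
          · exact isZero_of_isLE Z b i h
      obtain ⟨N, ⟨e⟩⟩ := exists_iso_singleFunctor_obj_of_isGE_of_isLE Z b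
      have hN : P N := P.prop_of_iso ((homologyFunctor A _).mapIso e ≪≫
        (singleFunctorCompHomologyFunctorIso A _).app N) (hZ.1 b)
      exact T.ext_of_isTriangulatedClosed₂ _ hΔ
        (ih a Y ((boundedHomology P).ext_of_isTriangulatedClosed₁
          ((TStructure.t.triangleLEGE (a + n) b hb).obj X) hΔ hX hZ) hYge hYle)
        (T.prop_of_iso e.symm (single _ N hN))
  obtain ⟨n, hn⟩ := hX.2
  exact key (2 * n) (-n) X hX
    ((isGE_iff _ _).2 fun i hi => hn i (by omega))
    ((isLE_iff _ _).2 fun i hi => hn i (by omega))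

end Derived

end ObjectProperty

open _root_.DerivedCategory in
/-- The homology of `F.mapDerivedCategory.obj X` is the image under `F` of the homology of `X`. -/
lemma Functor.boundedHomology_inverseImage {A B : Type*} [Category* A] [Category* B]
    [Abelian A] [Abelian B] [HasDerivedCategory.{w} A] [HasDerivedCategory.{v} B] (F : A ⥤ B)
    [F.Additive] [PreservesFiniteLimits F] [PreservesFiniteColimits F] [F.Faithful]
    (P : ObjectProperty B) [P.IsSerreClass] (X : DerivedCategory A)
    (hX : P.boundedHomology (F.mapDerivedCategory.obj X)) :
    (P.inverseImage F).boundedHomology X := by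
  let K := Q.objPreimage X
  have e (i : ℤ) : (homologyFunctor B i).obj (F.mapDerivedCategory.obj X) ≅
      F.obj ((homologyFunctor A i).obj X) :=
    (homologyFunctor B i).mapIso (F.mapDerivedCategory.mapIso (Q.objObjPreimageIso X).symm ≪≫
      F.mapDerivedCategoryFactors.app K) ≪≫ (homologyFunctorFactors B i).app _ ≪≫
      (K.sc i).mapHomologyIso F ≪≫ F.mapIso ((homologyFunctorFactors A i).symm.app K ≪≫
      (homologyFunctor A i).mapIso (Q.objObjPreimageIso X))
  obtain ⟨h, n, hn⟩ := hX
  refine ⟨fun i => P.prop_of_iso (e i) (h i), n, fun i hi => (IsZero.iff_id_eq_zero _).2 ?_⟩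
  exact F.map_injective (((hn i hi).of_iso (e i).symm).eq_of_src _ _)

end CategoryTheory

/-! ### Coinduced representations -/

namespace Rep

section ShortExact

variable {R : Type u} [CommRing R] {G : Type v} [Group G]

lemma shortExact_iff (S : ShortComplex (Rep.{w} R G)) :
    S.ShortExact ↔ (S.map (forget₂ (Rep.{w} R G) (ModuleCat.{w} R))).ShortExact := by
  constructor
  · intro hS
    exact hS.map_of_exact _
  · intro hS
    exact
      { exact := (S.exact_map_iff_of_faithful (forget₂ (Rep.{w} R G) (ModuleCat.{w} R))).1 hS.exact
        mono_f := (forget₂ (Rep.{w} R G) (ModuleCat.{w} R)).mono_of_mono_map hS.mono_f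
        epi_g := (forget₂ (Rep.{w} R G) (ModuleCat.{w} R)).epi_of_epi_map hS.epi_g }

lemma shortExact_of_functionExact {A B C : Rep.{w} R G} (f : A ⟶ B) (g : B ⟶ C)
    (hf : Function.Injective f.hom) (hg : Function.Surjective g.hom)
    (h : Function.Exact f.hom g.hom) (w : f ≫ g = 0) : (ShortComplex.mk f g w).ShortExact := by
  rw [shortExact_iff]
  exact
    { exact := (ShortComplex.ShortExact.moduleCat_exact_iff_function_exact _).2 h
      mono_f := (ModuleCat.mono_iff_injective _).2 hf
      epi_g := (ModuleCat.epi_iff_surjective _).2 hg }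

instance : (trivialFunctor.{w} R G).Additive where

lemma shortExact_map_trivialFunctor {S : ShortComplex (ModuleCat.{w} R)} (hS : S.ShortExact) :
    (S.map (trivialFunctor R G)).ShortExact := by
  rw [shortExact_iff]
  exact hS

lemma shortExact_subtype_mkQ (A : Rep.{w} R G) (W : Submodule R A)
    (hW : ∀ g, W ≤ W.comap (A.ρ g)) :
    (ShortComplex.mk (A.subtype W hW) (A.mkQ W hW) (by
      ext x; exact (Submodule.Quotient.mk_eq_zero W).2 x.2)).ShortExact :=
  shortExact_of_functionExact _ _ W.injective_subtype W.mkQ_surjective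
    (LinearMap.exact_subtype_mkQ W) _

end ShortExact

section Coind

variable {R : Type u} [CommRing R] {G : Type v} [Group G] [Finite G] (S : Subgroup G)

instance : (coindFunctor.{max u v} R S.subtype).Additive where

/-- Coinduction from a subgroup of finite index has adjoints on both sides. -/
lemma shortExact_map_coindFunctor {T : ShortComplex (Rep.{max u v} R S)} (hT : T.ShortExact) :
    (T.map (coindFunctor.{max u v} R S.subtype)).ShortExact := by
  have : (coindFunctor.{max u v} R S.subtype).IsLeftAdjoint :=
    instIsLeftAdjointSubtypeMemSubgroupCoindFunctorSubtype.{0, u, v}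
  exact hT.map_of_exact _

variable {S} in
/-- The terms `x • f x⁻¹` of the trace, as a function on the cosets `x S`: they do not depend on the
representative, as `f` is `S`-equivariant. -/
def traceTerm (M : Rep.{max u v} R G) (f : coind S.subtype (res S.subtype M)) : G ⧸ S → M :=
  Quotient.lift (fun x : G => M.ρ x (f.1 x⁻¹)) fun a b h => by
    have h' : f.1 (a⁻¹ * b * b⁻¹) = M.ρ (a⁻¹ * b) (f.1 b⁻¹) :=
      f.2 ⟨_, QuotientGroup.leftRel_apply.1 h⟩ b⁻¹
    rw [mul_inv_cancel_right] at h'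
    change M.ρ a (f.1 a⁻¹) = M.ρ b (f.1 b⁻¹)
    rw [h', ← Module.End.mul_apply, ← map_mul, mul_inv_cancel_left]

attribute [local instance] Fintype.ofFinite in
/-- The trace `f ↦ ∑ x • f x⁻¹`, the sum running over the cosets `x S`. -/
noncomputable def coindTrace (M : Rep.{max u v} R G) :
    coind S.subtype (res S.subtype M) ⟶ M :=
  Rep.ofHom
    (LinearMap.intertwiningMap_of_isIntertwiningMap _ _
      { toFun := fun f => ∑ x : G ⧸ S, traceTerm M f x
        map_add' := fun f g => by
          rw [← Finset.sum_add_distrib]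
          refine Finset.sum_congr rfl fun x _ => ?_
          induction x using QuotientGroup.induction_on with
          | H x => exact map_add (M.ρ x) _ _
        map_smul' := fun r f => by
          rw [Finset.smul_sum]
          refine Finset.sum_congr rfl fun x _ => ?_
          induction x using QuotientGroup.induction_on with
          | H x => exact map_smul (M.ρ x) _ _ } fun g f => by
        change ∑ x : G ⧸ S, _ = M.ρ g (∑ x : G ⧸ S, _)
        rw [map_sum]
        symm
        refine Fintype.sum_equiv (MulAction.toPerm g) _ _ fun x => ?_
        induction x using QuotientGroup.induction_on with
        | H x =>
          change M.ρ g (M.ρ x (f.1 x⁻¹)) = M.ρ (g * x) (f.1 ((g * x)⁻¹ * g))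
          rw [map_mul, Module.End.mul_apply, mul_inv_rev, inv_mul_cancel_right])

attribute [local instance] Fintype.ofFinite in
/-- The composite of the unit `m ↦ (g ↦ g • m)` with the trace is multiplication by the index. -/
lemma resCoindToHom_comp_coindTrace (M : Rep.{max u v} R G) :
    resCoindToHom S.subtype M (res S.subtype M) (𝟙 _) ≫ coindTrace S M = S.index • 𝟙 M := by
  ext m
  change ∑ x : G ⧸ S, traceTerm M _ x = S.index • m
  rw [Finset.sum_eq_card_nsmul (b := m)]
  · rw [Finset.card_univ, ← Nat.card_eq_fintype_card]
    rfl
  · intro x _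
    induction x using QuotientGroup.induction_on with
    | H x =>
      change M.ρ x (M.ρ x⁻¹ m) = m
      simp

/-- Functions on `G` that are invariant under left translation by `S`, with values in `R`, form the
permutation module on `G ⧸ S`: to `f` corresponds the function `x S ↦ f x⁻¹` on cosets. -/
noncomputable def coindTrivialIso :
    coind S.subtype (trivial R S (ULift.{v} R)) ≅ ofMulAction R G (G ⧸ S) :=
  let toFun (f : Representation.coindV S.subtype (trivial R S (ULift.{v} R)).ρ) : G ⧸ S → R :=
    Quotient.lift (fun x : G => (f.1 x⁻¹).down) fun a b h => by
      have h' : f.1 (a⁻¹ * b * b⁻¹) = f.1 b⁻¹ := f.2 ⟨_, QuotientGroup.leftRel_apply.1 h⟩ b⁻¹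
      rw [mul_inv_cancel_right] at h'
      exact congrArg ULift.down h'
  mkIso (Representation.Equiv.mk
    { toFun := fun f => (MonoidAlgebra.coeffLinearEquiv R).symm
        ((Finsupp.linearEquivFunOnFinite R R (G ⧸ S)).symm (toFun f))
      map_add' := fun f g => by
        rw [← map_add, ← map_add]
        congr 2
        ext x
        induction x using QuotientGroup.induction_on with
        | H x => rfl
      map_smul' := fun r f => by
        rw [← map_smul, ← map_smul]
        congr 2
        ext x
        induction x using QuotientGroup.induction_on with
        | H x => rfl
      invFun := fun a => ⟨fun x => ⟨a.coeff ((x⁻¹ : G) : G ⧸ S)⟩, fun s x => by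
        change ULift.up _ = ULift.up _
        congr 2
        exact QuotientGroup.eq.2 (by simp)⟩
      left_inv := fun f => by
        ext x
        change (f.1 x⁻¹⁻¹).down = (f.1 x).down
        rw [inv_inv]
      right_inv := fun a => by
        ext x
        induction x using QuotientGroup.induction_on with
        | H x =>
          change a.coeff ((x⁻¹⁻¹ : G) : G ⧸ S) = a.coeff (x : G ⧸ S)
          rw [inv_inv] } fun g => by
      ext f x
      induction x using QuotientGroup.induction_on with
      | H x =>
        refine Eq.trans ?_ (Representation.coeff_ofMulAction g _ _).symm
        change (f.1 (x⁻¹ * g)).down = (f.1 (g⁻¹ * x)⁻¹).down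
        rw [mul_inv_rev, inv_inv])

end Coind

end Rep

/-- A nonzero `p`-torsion representation of a finite `p`-group has a nonzero invariant vector. -/
lemma IsPGroup.exists_ne_zero_forall_apply_eq {p : ℕ} [Fact p.Prime] {S : Type*} [Group S]
    [Finite S] (hS : IsPGroup p S) {Q : Type*} [AddCommGroup Q] [Nontrivial Q]
    (hQ : ∀ q : Q, p • q = 0) {R : Type*} [Semiring R] [Module R Q] (ρ : Representation R S Q) :
    ∃ q ≠ 0, ∀ s, ρ s q = q := by
  obtain ⟨x, hx⟩ := exists_ne (0 : Q)
  -- The subgroup generated by the orbit of `x` is finite, so that fixed points can be counted.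
  let A : AddSubgroup Q := AddSubgroup.closure (Set.range fun s => ρ s x)
  have hA (s : S) (a : A) : ρ s a ∈ A := by
    have : A ≤ A.comap (ρ s).toAddMonoidHom := by
      rw [AddSubgroup.closure_le]
      rintro _ ⟨t, rfl⟩
      refine AddSubgroup.subset_closure ⟨s * t, ?_⟩
      simp
    exact this a.2
  let : MulAction S A :=
    { smul := fun s a => ⟨ρ s a, hA s a⟩
      one_smul := fun a => Subtype.ext (by change ρ 1 (a : Q) = a; simp)
      mul_smul := fun s t a => Subtype.ext (by change ρ (s * t) (a : Q) = ρ s (ρ t a); simp) }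
  have hpA (a : A) : p • a = 0 := Subtype.ext (hQ a)
  have : AddGroup.FG A := AddGroup.closure_finite_fg _
  have : Finite A := AddCommGroup.finite_of_fg_isAddTorsion A fun a =>
    isOfFinAddOrder_iff_nsmul_eq_zero.2 ⟨p, (Fact.out : p.Prime).pos, hpA a⟩
  let x' : A := ⟨x, AddSubgroup.subset_closure ⟨1, by simp⟩⟩
  have hx' : x' ≠ 0 := fun h => hx (congrArg Subtype.val h)
  have hcard : p ∣ Nat.card A :=
    addOrderOf_eq_prime (hpA x') hx' ▸ addOrderOf_dvd_natCard x'
  obtain ⟨b, hb, h0⟩ := hS.exists_fixed_point_of_prime_dvd_card_of_fixed_point A hcard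
    (a := (0 : A)) (fun s => Subtype.ext (map_zero (ρ s)))
  exact ⟨b, fun h => h0 (Subtype.ext h.symm), fun s => congrArg Subtype.val (hb s)⟩

/-! ### Finitely generated representations -/

namespace CategoryTheory.ObjectProperty.IsThick

open Rep

section PGroup

variable {R : Type u} [CommRing R] [IsNoetherianRing R] {S : Type v} [Group S] [Finite S]
  {P : ObjectProperty (Rep.{w} R S)}

/-- A thick property of representations of a finite `p`-group which holds for the finitely generated
trivial ones holds for the finitely generated `p`-torsion ones, as these have a finite
filtration with trivial quotients. -/
lemma of_isPGroup (hP : P.IsThick)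
    (htriv : ∀ N : ModuleCat.{w} R, Module.Finite R N → P (trivial R S N)) {p : ℕ} [Fact p.Prime]
    (hS : IsPGroup p S) (V : Rep.{w} R S) [Module.Finite R V] (hV : ∀ x : V, p • x = 0) : P V := by
  let 𝒲 : Set (Submodule R V) :=
    {W | ∃ hW : ∀ s, W ≤ W.comap (V.ρ s), P (V.subrepresentation W hW)}
  have hbot : (⊥ : Submodule R V) ∈ 𝒲 :=
    ⟨fun s => bot_le, hP.of_isZero
      ((Rep.isZero_iff _ _ _).2 (inferInstanceAs (Subsingleton (⊥ : Submodule R V))))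
      (htriv (ModuleCat.of R PUnit) inferInstance)⟩
  obtain ⟨W, ⟨hW, hPW⟩, hmax⟩ := wellFounded_gt.has_min 𝒲 ⟨⊥, hbot⟩
  -- `W'` is the preimage of the invariants of `V ⧸ W`; it belongs to `𝒲`, and it is larger than the
  -- maximal element `W` unless `W = ⊤`.
  let W' : Submodule R V :=
    { carrier := {x | ∀ s, V.ρ s x - x ∈ W}
      add_mem' := fun {x y} hx hy s => by
        rw [map_add, add_sub_add_comm]
        exact W.add_mem (hx s) (hy s)
      zero_mem' := fun s => by simp
      smul_mem' := fun r x hx s => by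
        rw [map_smul, ← smul_sub]
        exact W.smul_mem r (hx s) }
  have hle : W ≤ W' := fun x hx s => W.sub_mem (hW s hx) hx
  have hW' (s : S) : W' ≤ W'.comap (V.ρ s) := fun x hx t => by
    have : V.ρ t (V.ρ s x) - V.ρ s x = (V.ρ (t * s) x - x) - (V.ρ s x - x) := by
      simp
    rw [this]
    exact W.sub_mem (hx _) (hx _)
  let Q := W' ⧸ W.submoduleOf W'
  let f : V.subrepresentation W hW ⟶ V.subrepresentation W' hW' :=
    Rep.ofHom ⟨Submodule.inclusion hle, fun s => rfl⟩
  let g : V.subrepresentation W' hW' ⟶ trivial R S Q :=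
    Rep.ofHom ⟨(W.submoduleOf W').mkQ, fun s => by
      ext x
      exact (Submodule.Quotient.eq _).2 (x.2 s)⟩
  have hfg : Function.Exact f.hom g.hom := by
    intro x
    refine (Submodule.Quotient.mk_eq_zero _).trans ⟨fun h => ⟨⟨x.1, h⟩, rfl⟩, ?_⟩
    rintro ⟨y, rfl⟩
    exact y.2
  have hS' := shortExact_of_functionExact f g (Submodule.inclusion_injective hle)
    (Submodule.mkQ_surjective _) hfg (by
      ext x; exact hfg.apply_apply_eq_zero x)
  have hPW' : P (V.subrepresentation W' hW') :=
    hP.X₂ hS' hPW (htriv (ModuleCat.of R Q) (inferInstanceAs (Module.Finite R Q)))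
  have htop : W = ⊤ := by
    by_contra hne
    have : Nontrivial (V ⧸ W) := Submodule.Quotient.nontrivial_iff.2 hne
    obtain ⟨q, hq0, hq⟩ := hS.exists_ne_zero_forall_apply_eq (Q := V ⧸ W) (fun q => by
      obtain ⟨x, rfl⟩ := W.mkQ_surjective q
      rw [← map_nsmul, hV, map_zero]) (V.ρ.quotient W hW)
    obtain ⟨x, rfl⟩ := W.mkQ_surjective q
    refine hmax W' ⟨hW', hPW'⟩ (lt_of_le_of_ne hle ?_)
    intro h
    refine hq0 ((Submodule.Quotient.mk_eq_zero W).2 ?_)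
    rw [h]
    exact fun s => (Submodule.Quotient.eq W).1 (hq s)
  subst htop
  exact hP.of_iso (Rep.mkIso (.mk Submodule.topEquiv fun s => rfl)) hPW

end PGroup

section Permutation

variable {R : Type u} [CommRing R] [IsRegularRing R] (hdim : ringKrullDim R ≠ ⊤)
  {G : Type v} [Group G] [Finite G] {P : ObjectProperty (Rep.{max u v} R G)} (hP : P.IsThick)
  (hperm : ∀ H : Subgroup G, P (ofMulAction R G (G ⧸ H)))

include hdim hP hperm

/-- The functor `N ↦ coind (trivial N)` is exact and sends `R` to the permutation module on `G ⧸ S`;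
as `N` has a finite resolution by finite projective modules, its image is reached from that. -/
lemma coind_trivial (S : Subgroup G) (N : ModuleCat.{max u v} R) (hN : Module.Finite R N) :
    P (coind S.subtype (trivial R S N)) := by
  obtain ⟨n, hn⟩ := IsRegularRing.exists_hasProjectiveDimensionLE.{u, v} hdim
  have h₁ := hP.inverseImage (coindFunctor.{max u v} R S.subtype) (shortExact_map_coindFunctor S)
  have h₂ := h₁.inverseImage (trivialFunctor.{max u v} R S) shortExact_map_trivialFunctor
  have := hn N
  exact h₂.of_finite_of_hasProjectiveDimensionLE (hP.of_iso (coindTrivialIso S).symm (hperm S)) n N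

/-- A `p`-torsion representation is a retract of the coinduction of its restriction to a Sylow
`p`-subgroup. -/
lemma of_prime_nsmul_eq_zero {p : ℕ} (hp : p.Prime) (M : Rep.{max u v} R G) [Module.Finite R M]
    (hM : ∀ x : M, p • x = 0) : P M := by
  have : Fact p.Prime := ⟨hp⟩
  let S : Sylow p G := default
  have hD := (hP.inverseImage (coindFunctor.{max u v} R S.1.subtype)
    (shortExact_map_coindFunctor S.1)).of_isPGroup (hP.coind_trivial hdim hperm S.1) S.2
      (res S.1.subtype M) hM
  -- As `[G : S]` is prime to `p`, some multiple of the trace splits the unit.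
  obtain ⟨a, b, hab⟩ : IsCoprime (S.1.index : ℤ) (p : ℤ) :=
    Nat.isCoprime_iff_coprime.2 (((Nat.Prime.coprime_iff_not_dvd hp).2 S.not_dvd_index).symm)
  have hp0 : p • 𝟙 M = 0 := by
    ext x
    exact hM x
  refine hP.of_retract ⟨resCoindToHom S.1.subtype M (res S.1.subtype M) (𝟙 _),
    a • coindTrace S.1 M, ?_⟩ hD
  rw [Preadditive.comp_zsmul, resCoindToHom_comp_coindTrace, ← natCast_zsmul, smul_smul,
    eq_sub_of_add_eq hab, sub_smul, one_smul, mul_smul, natCast_zsmul, hp0, smul_zero, sub_zero]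

lemma of_nsmul_eq_zero {n : ℕ} (hn : n ≠ 0) (M : Rep.{max u v} R G) [Module.Finite R M]
    (hM : ∀ x : M, n • x = 0) : P M := by
  induction n using induction_on_primes generalizing M with
  | zero => exact absurd rfl hn
  | one =>
    have h0 (x : M) : x = 0 := (one_nsmul x).symm.trans (hM x)
    exact hP.of_isZero ((Rep.isZero_iff _ _ _).2 ⟨fun x y => (h0 x).trans (h0 y).symm⟩) (hperm ⊥)
  | prime_mul p a hp ih =>
    -- The submodule `p M` is killed by `a`, and the quotient by it is killed by `p`.
    let W : Submodule R M := LinearMap.range (p • (LinearMap.id : M →ₗ[R] M))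
    have hW (g : G) : W ≤ W.comap (M.ρ g) := by
      rintro _ ⟨x, rfl⟩
      exact ⟨M.ρ g x, (map_nsmul (M.ρ g) p x).symm⟩
    refine hP.X₂ (shortExact_subtype_mkQ M W hW) ?_ ?_
    · refine ih (right_ne_zero_of_mul hn) (M.subrepresentation W hW) ?_
      rintro ⟨_, x, rfl⟩
      refine Subtype.ext ?_
      change a • p • x = 0
      rw [smul_smul, mul_comm, hM]
    · refine hP.of_prime_nsmul_eq_zero hdim hperm hp (M.quotient W hW) ?_
      intro q
      obtain ⟨x, rfl⟩ := W.mkQ_surjective q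
      exact (Submodule.Quotient.mk_eq_zero W).2 ⟨x, rfl⟩

end Permutation

end CategoryTheory.ObjectProperty.IsThick

namespace Rep

open CategoryTheory ObjectProperty

variable {R : Type u} [CommRing R] [IsRegularRing R] (hdim : ringKrullDim R ≠ ⊤)
  {G : Type v} [Group G] [Finite G] [HasDerivedCategory.{w} (Rep.{max u v} R G)]
  (T : ObjectProperty (DerivedCategory (Rep.{max u v} R G))) [T.IsTriangulated]
  [T.IsStableUnderRetracts]

include hdim in
/-- A thick subcategory of `D(R[G])` containing the permutation modules contains all finitely
generated modules. -/
theorem prop_singleFunctor_of_finite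
    (hperm : ∀ H : Subgroup G, T ((DerivedCategory.singleFunctor (Rep.{max u v} R G) 0).obj
      (ofMulAction R G (G ⧸ H)))) (M : Rep.{max u v} R G) (hM : Module.Finite R M) :
    T ((DerivedCategory.singleFunctor (Rep.{max u v} R G) 0).obj M) := by
  have hP := isThick_inverseImage_singleFunctor T
  let e : (⊥ : Subgroup G) →* G := (⊥ : Subgroup G).subtype
  have hcomp := resCoindToHom_comp_coindTrace (S := ⊥) M
  have hc : Nat.card G ≠ 0 := Nat.card_pos.ne'
  rw [Subgroup.index_bot] at hcomp
  -- Multiplication by the order of `G` factors through the coinduction from the trivial subgroup,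
  -- and its kernel and cokernel are torsion.
  refine T.prop_singleFunctor_of_comp (resCoindToHom e M (res e M) (𝟙 _)) (coindTrace ⊥ M) ?_ ?_ ?_
  · let i : res e M ≅ trivial R (⊥ : Subgroup G) M :=
      mkIso (.mk (LinearEquiv.refl R M) fun s => by
        ext x
        obtain rfl := Subsingleton.elim s 1
        simp)
    exact hP.of_iso ((coindFunctor.{max u v} R e).mapIso i).symm
      (hP.coind_trivial hdim hperm ⊥ (ModuleCat.of R M) hM)
  · rw [hcomp]
    let ι := kernel.ι (Nat.card G • 𝟙 M)
    have hι : Function.Injective ι.hom.toLinearMap :=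
      (mono_iff_injective ι).1 (inferInstanceAs (Mono (kernel.ι _)))
    have := Module.Finite.of_injective _ hι
    refine hP.of_nsmul_eq_zero hdim hperm hc _ fun x => hι ?_
    rw [map_nsmul, map_zero]
    exact congr($(kernel.condition (Nat.card G • 𝟙 M)).hom x)
  · rw [hcomp]
    let π := cokernel.π (Nat.card G • 𝟙 M)
    have hπ : Function.Surjective π.hom.toLinearMap :=
      (epi_iff_surjective π).1 (inferInstanceAs (Epi (cokernel.π _)))
    have := Module.Finite.of_surjective _ hπ
    refine hP.of_nsmul_eq_zero hdim hperm hc _ fun y => ?_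
    obtain ⟨x, rfl⟩ := hπ y
    rw [← map_nsmul]
    exact congr($(cokernel.condition (Nat.card G • 𝟙 M)).hom x)

end Rep

/-! ### Perfect complexes with a group action -/

namespace CategoryTheory.ObjectProperty

section FullSubcategory

variable {C : Type*} [Category* C] (P : ObjectProperty C) (T : ObjectProperty P.FullSubcategory)

/-- Retracts of objects of the full subcategory are computed in the ambient category. -/
instance isStableUnderRetracts_map_ι [P.IsStableUnderRetracts] [T.IsStableUnderRetracts] :
    (T.map P.ι).IsStableUnderRetracts where
  of_retract {X Y} r hY := by
    rw [prop_map_iff] at hY ⊢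
    obtain ⟨Z, hZ, ⟨e⟩⟩ := hY
    let X' : P.FullSubcategory := ⟨X, P.prop_of_retract (r.trans e.symm.retract) Z.2⟩
    let r' : Retract X' Z :=
      { i := P.fullyFaithfulι.preimage (r.i ≫ e.inv)
        r := P.fullyFaithfulι.preimage (e.hom ≫ r.r)
        retract := P.ι.map_injective (by simp [X']) }
    exact ⟨X', T.prop_of_retract r' hZ, ⟨Iso.refl _⟩⟩

lemma prop_of_prop_map_ι [T.IsClosedUnderIsomorphisms] (X : P.FullSubcategory)
    (hX : T.map P.ι X.obj) : T X := by
  rw [prop_map_iff] at hX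
  obtain ⟨Z, hZ, ⟨e⟩⟩ := hX
  exact T.prop_of_iso (P.fullyFaithfulι.preimageIso e) hZ

end FullSubcategory

end CategoryTheory.ObjectProperty

namespace ModuleCat

variable (R : Type u) [CommRing R]

/-- The property of being a finitely generated module. -/
def isFinitelyGenerated : ObjectProperty (ModuleCat.{w} R) := fun M => Module.Finite R M

instance [IsNoetherianRing R] : (isFinitelyGenerated.{u, w} R).IsSerreClass where
  exists_zero := ⟨ModuleCat.of R PUnit, (ModuleCat.isZero_iff_subsingleton).2 inferInstance,
    inferInstanceAs (Module.Finite R PUnit.{w + 1})⟩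
  prop_of_mono f _ hN := by
    have : Module.Finite R _ := hN
    exact Module.Finite.of_injective f.hom ((ModuleCat.mono_iff_injective f).1 inferInstance)
  prop_of_epi f _ hM := by
    have : Module.Finite R _ := hM
    exact Module.Finite.of_surjective f.hom ((ModuleCat.epi_iff_surjective f).1 inferInstance)
  prop_X₂_of_shortExact {S} hS h₁ h₃ := by
    have : Module.Finite R S.X₁ := h₁
    have : Module.Finite R S.X₃ := h₃
    exact Module.Finite.of_exact (f := S.f.hom) (g := S.g.hom)
      ((ShortComplex.ShortExact.moduleCat_exact_iff_function_exact _).1 hS.exact)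
      ((ModuleCat.epi_iff_surjective _).1 hS.epi_g)

end ModuleCat

namespace PerfectRep

open ObjectProperty

/-- Perfect complexes have bounded, finitely generated homology. -/
lemma isPerfect_le_boundedHomology (R : Type u) [CommRing R] [IsNoetherianRing R]
    [HasDerivedCategory.{w₁} (ModuleCat.{max u v} R)] :
    IsPerfect.{u, v} R ≤ (ModuleCat.isFinitelyGenerated.{u, max u v} R).boundedHomology := by
  unfold IsPerfect
  rw [triangEnvelope_le_iff]
  rw [singleton_le_iff]
  exact boundedHomology_singleFunctor _ _ (inferInstanceAs (Module.Finite R (ULift.{v} R)))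

end PerfectRep

theorem mainTheorem7 (R : Type u) [CommRing R] [IsRegularRing R] (hdim : ringKrullDim R ≠ ⊤)
    (G : Type v) [Group G] [Finite G]
    [HasDerivedCategory.{w₁} (ModuleCat.{max u v} R)]
    [HasDerivedCategory.{w₂} (Rep.{max u v} R G)] :
    (ObjectProperty.ofObj fun H : Subgroup G =>
      PerfectRep.permutationModule.{u, v} R G H).IsClassicalTriangulatedGenerator := by
  let P := PerfectRep.IsUnderlyingPerfect.{u, v} R G
  let T := (ObjectProperty.ofObj fun H : Subgroup G =>
    PerfectRep.permutationModule.{u, v} R G H).triangEnvelope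
  have hperm (H : Subgroup G) :
      T.map P.ι ((DerivedCategory.singleFunctor (Rep.{max u v} R G) 0).obj
        (Rep.ofMulAction R G (G ⧸ H))) :=
    T.prop_map_obj P.ι (ObjectProperty.le_triangEnvelope _ _ (ObjectProperty.ofObj_apply _ H))
  rw [ObjectProperty.isClassicalTriangulatedGenerator_iff, eq_top_iff]
  intro X _
  refine P.prop_of_prop_map_ι T X ?_
  exact ObjectProperty.prop_of_boundedHomology
    ((ModuleCat.isFinitelyGenerated.{u, max u v} R).inverseImage
      (forget₂ (Rep.{max u v} R G) (ModuleCat.{max u v} R))) (T.map P.ι)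
    (Rep.prop_singleFunctor_of_finite hdim _ hperm) _
    ((forget₂ (Rep.{max u v} R G) (ModuleCat.{max u v} R)).boundedHomology_inverseImage
      (ModuleCat.isFinitelyGenerated.{u, max u v} R) X.obj
      (PerfectRep.isPerfect_le_boundedHomology.{u, v} R _ X.2))
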